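/- Theorem. There is an absolute constant $K<\infty$ such that the following holds. Let $\mathcal X$ be a compact metric space, let $\mathcal M(\mathcal X)$ be the set of Borel measures of finite mass on $\mathcal X$, and let $\mathcal F$ be a class of Borel measurable functions $\mathcal X\to[0,1]$. Let $\mathrm{VC}(\mathcal F)\in\{0,1,2,\dots\}\cup\{\infty\}$ be its pseudo-dimension, that is, the supremum of the cardinalities of the finite sets $S\subset\mathcal X$ for which there is a function $r:S\to\mathbb R$ such that for every $T\subset S$ some $f\in\mathcal F$ satisfies $f(x)>r(x)$ for $x\in T$ and $f(x)\le r(x)$ for $x\in S\setminus T$ (for $\{0,1\}$-valued functions this is the Vapnik–Chervonenkis dimension), and assume that $\mathrm{VC}(\mathcal F)\ge 1$. For $f\in\mathcal F$ and $\mu\in\mathcal M(\mathcal X)$ put $\tilde f[\mu]=\int_{\mathcal X} f\,\mathrm d\mu$, and let $\tilde{\mathcal F}=\{\tilde f : f\in\mathcal F\}$. Then for every $N\ge 1$ and all $\mu_1,\dots,\mu_N\in\mathcal M(\mathcal X)$, the empirical Rademacher complexity $$\mathcal R_N(\tilde{\mathcal F})=\frac1N\,\mathbb E_\sigma\Big[\sup_{f\in\mathcal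 F}\Big|\sum_{i=1}^N\sigma_i\,\tilde f[\mu_i]\Big|\Big],$$ where $\sigma_1,\dots,\sigma_N$ are independent and uniform on $\{-1,1\}$, satisfies $$\mathcal R_N(\tilde{\mathcal F})\le\frac{K\,\bar M_2\sqrt{\mathrm{VC}(\mathcal F)}}{\sqrt N},\qquad \bar M_2=\Big(\frac1N\sum_{i=1}^N\mu_i(\mathcal X)^2\Big)^{1/2},$$ with the convention $0\cdot\infty=0$ on the right-hand side. -/

import Mathlib

open MeasureTheory
open scoped ENNReal NNReal

noncomputable section

/-- The finite set `S` is (pseudo-)shattered by the class `F` of real functions: there are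
thresholds `r` such that every subset `T` of `S` is cut out by some `f ∈ F`, i.e. on `S` the
function `f` exceeds the threshold exactly at the points of `T`. -/
def PseudoShatters {X : Type*} (F : Set (X → ℝ)) (S : Finset X) : Prop :=
  ∃ r : X → ℝ, ∀ T ⊆ S, ∃ f ∈ F, ∀ x ∈ S, (r x < f x ↔ x ∈ T)

/-- The pseudo-dimension of a class of real functions (for `{0,1}`-valued functions, its
Vapnik-Chervonenkis dimension): the supremum of the cardinalities of the shattered sets. -/
def vcDim {X : Type*} (F : Set (X → ℝ)) : ℕ∞ :=
  ⨆ (S : Finset X) (_ : PseudoShatters F S), (S.card : ℕ∞)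

/-- The empirical Rademacher complexity
`(1/N) E_σ [ sup_{g ∈ G} |∑ i, σ i * g (z i)| ]` of a class `G` of real functions, given the sample
`z`. The signs `σ i` are independent and uniform on `{-1, 1}`, so the expectation is the average
over the `2 ^ N` sign vectors. The value is extended, so that the supremum is never a junk value. -/
def rademacherComplexity {Z : Type*} (G : Set (Z → ℝ)) {N : ℕ} (z : Fin N → Z) : ℝ≥0∞ :=
  (N : ℝ≥0∞)⁻¹ * ((2 ^ N : ℝ≥0∞)⁻¹ *
    ∑ σ : Fin N → ℤˣ, ⨆ g ∈ G, ENNReal.ofReal |∑ i, ((σ i : ℤ) : ℝ) * g (z i)|)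

/-- The class of the maps `μ ↦ ∫ f dμ`, `f ∈ F`, on measures of finite mass. -/
def integralClass {X : Type*} [MeasurableSpace X] (F : Set (X → ℝ)) :
    Set (FiniteMeasure X → ℝ) :=
  (fun (f : X → ℝ) (μ : FiniteMeasure X) => ∫ x, f x ∂(μ : Measure X)) '' F

/-- The quadratic mean of the total masses of the measures `μ 1, …, μ N`. -/
def quadraticMeanMass {X : Type*} [MeasurableSpace X] {N : ℕ} (μ : Fin N → FiniteMeasure X) :
    ℝ≥0 :=
  NNReal.sqrt ((∑ i, (μ i).mass ^ 2) / (N : ℝ≥0))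

end

/-!
Since `f x` is the length of `{t ∈ (0, 1] | t < f x}`, the integral of `f` against a finite measure
`μ i` is `(μ i).mass` times the probability that a random point `(x, t)` of `X × (0, 1]`, with `x`
distributed as the normalised `μ i` and `t` uniform, lies below the graph of `f`. Taking these
points independent over `i` and moving the expectation outside the absolute values and the suprema
(Jensen's inequality, `sum_abs_signSum_integral_le`), it is enough to bound, for fixed points,
the expected supremum of `|∑ i ∈ A, σ i * m i|`, where `m i = (μ i).mass` and `A` runs over the
traces of the subgraphs on the given points. The VC dimension of this family of finite sets is at
most the pseudo-dimension of `F` (`vcDim_subgraphTraces_le`).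

For a family of VC dimension at most `d ≥ 1` and weights with `∑ i, m i ^ 2 = 1`, the bound
`21 * √d` comes from chaining in the pseudometric whose square is the sum of `m i ^ 2` over the
symmetric difference. A `δ`-separated subfamily (`δ` measured on squared distances) has at most
`exp (1 / 2) * (4 / δ) ^ (2 * d)` members (`card_le_of_separated`): sampling indices from the
distribution `m i ^ 2` finds few indices on which all members have distinct traces, and the traces
are counted by Pajor's form of the Sauer-Shelah lemma. So the net at scale `2 ^ (-k)` has
logarithmic cardinality `O(d * (k + 1))`, each link of the chain costs
`O(2 ^ (-k) * √d * (k + 1))` by the maximal inequality for sub-Gaussian sums, and the links have a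
finite sum without any logarithmic factor.

An expected supremum is handled through selections throughout: a bound on
`∑ σ, ⨆ j, a σ j` is the same as a bound on `∑ σ, a σ (τ σ)` uniform in the functions `τ` that
pick an index for each sign vector (`ENNReal.sum_iSup_le_of_forall_selection`). This makes every
supremum a finite sum, and no measurability of suprema is needed.
-/

/-! ### Maximal inequality for Rademacher sums -/

theorem sum_exp_signSum {ι : Type*} [Fintype ι] [DecidableEq ι] (a : ι → ℝ) :
    ∑ σ : ι → ℤˣ, Real.exp (∑ i, ((σ i : ℤ) : ℝ) * a i) = ∏ i, (2 * Real.cosh (a i)) := by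
  simp_rw [Real.exp_sum]
  have : ∀ i, 2 * Real.cosh (a i) = ∑ u : ℤˣ, Real.exp (((u : ℤ) : ℝ) * a i) := by
    intro i
    rw [Real.cosh_eq, show (Finset.univ : Finset ℤˣ) = {1, -1} from rfl]
    simp
    ring
  simp_rw [this, Finset.prod_univ_sum, Fintype.piFinset_univ]

theorem sum_exp_signSum_le {ι : Type*} [Fintype ι] [DecidableEq ι] (a : ι → ℝ) {v : ℝ}
    (h : ∑ i, a i ^ 2 ≤ v) :
    ∑ σ : ι → ℤˣ, Real.exp (∑ i, ((σ i : ℤ) : ℝ) * a i) ≤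
      2 ^ Fintype.card ι * Real.exp (v / 2) := by
  rw [sum_exp_signSum, Finset.prod_mul_distrib, Finset.prod_const, Finset.card_univ]
  gcongr
  calc ∏ i, Real.cosh (a i) ≤ ∏ i, Real.exp (a i ^ 2 / 2) :=
        Finset.prod_le_prod (fun i _ => (Real.cosh_pos _).le)
          fun i _ => Real.cosh_le_exp_half_sq _
    _ = Real.exp ((∑ i, a i ^ 2) / 2) := by rw [← Real.exp_sum, Finset.sum_div]
    _ ≤ _ := by gcongr

/-- Massart's maximal inequality: the expected maximum of `|∑ i, σ i * a j i|` over `j ∈ P` is at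
most `3 / 2 * s * √h` when all variances are at most `s ^ 2` and `log (2 * #P) ≤ h`. The maximum is
expressed by the selection `τ`. -/
theorem sum_abs_signSum_selection_le {ι J : Type*} [Fintype ι] [DecidableEq ι]
    (P : Finset J) (a : J → ι → ℝ) {s h : ℝ} (hs : 0 < s) (hh : 0 < h)
    (hvar : ∀ j ∈ P, ∑ i, a j i ^ 2 ≤ s ^ 2) (hP : 2 * (P.card : ℝ) ≤ Real.exp h)
    (τ : (ι → ℤˣ) → J) (hτ : ∀ σ, τ σ ∈ P) :
    ∑ σ : ι → ℤˣ, |∑ i, ((σ i : ℤ) : ℝ) * a (τ σ) i| ≤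
      2 ^ Fintype.card ι * (3 / 2 * s * √h) := by
  -- The exponent that balances `h / l` against the variance term `l * s ^ 2 / 2`.
  set l : ℝ := √h / s with hl
  have hlpos : 0 < l := div_pos (Real.sqrt_pos.2 hh) hs
  have hls : l ^ 2 * s ^ 2 = h := by
    rw [hl, div_pow, Real.sq_sqrt hh.le]; field_simp
  set Y : J → (ι → ℤˣ) → ℝ := fun j σ => ∑ i, ((σ i : ℤ) : ℝ) * a j i with hY
  set E : ℝ := 2 ^ Fintype.card ι with hE
  have hexp : ∀ c : ℝ, c ^ 2 = l ^ 2 → ∀ j ∈ P,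
      ∑ σ, Real.exp (c * Y j σ) ≤ E * Real.exp (h / 2) := by
    intro c hc j hj
    have := sum_exp_signSum_le (fun i => c * a j i) (v := h) (by
      simp_rw [mul_pow, hc]
      rw [← Finset.mul_sum, ← hls]
      exact mul_le_mul_of_nonneg_left (hvar j hj) (sq_nonneg l))
    convert this using 4
    simp only [hY, Finset.mul_sum]
    exact Finset.sum_congr rfl fun i _ => by ring
  -- `t ≤ c - 1 + exp (t - c)` with `c = 3 / 2 * h` replaces the usual logarithm of the expectation,
  -- and the exponential of the selected term is bounded by the sum of all of them.
  have hpt : ∀ σ, l * |Y (τ σ) σ| ≤ 3 / 2 * h - 1 + Real.exp (-(3 / 2 * h)) *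
      ∑ j ∈ P, (Real.exp (l * Y j σ) + Real.exp (-l * Y j σ)) := by
    intro σ
    have h1 : l * |Y (τ σ) σ| ≤ 3 / 2 * h - 1 +
        Real.exp (-(3 / 2 * h)) * Real.exp (l * |Y (τ σ) σ|) := by
      rw [← Real.exp_add]
      linarith [Real.add_one_le_exp (-(3 / 2 * h) + l * |Y (τ σ) σ|)]
    refine h1.trans ?_
    gcongr
    calc Real.exp (l * |Y (τ σ) σ|)
        ≤ Real.exp (l * Y (τ σ) σ) + Real.exp (-l * Y (τ σ) σ) := by
          rcases abs_choice (Y (τ σ) σ) with h' | h' <;> rw [h']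
          · linarith [Real.exp_pos (-l * Y (τ σ) σ)]
          · rw [mul_neg, ← neg_mul]; linarith [Real.exp_pos (l * Y (τ σ) σ)]
      _ ≤ _ := Finset.single_le_sum (f := fun j => Real.exp (l * Y j σ) + Real.exp (-l * Y j σ))
          (fun j _ => by positivity) (hτ σ)
  have hsum : l * ∑ σ, |Y (τ σ) σ| ≤ E * (3 / 2 * h) := by
    rw [Finset.mul_sum]
    refine (Finset.sum_le_sum fun σ _ => hpt σ).trans ?_
    rw [Finset.sum_add_distrib, ← Finset.mul_sum, Finset.sum_comm]
    have hcard : ∑ _σ : ι → ℤˣ, (3 / 2 * h - 1) = E * (3 / 2 * h - 1) := by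
      simp [hE]
      ring
    have h2 : ∑ j ∈ P, ∑ σ, (Real.exp (l * Y j σ) + Real.exp (-l * Y j σ)) ≤
        E * Real.exp (3 / 2 * h) := by
      calc _ ≤ ∑ j ∈ P, (2 * (E * Real.exp (h / 2))) := by
            refine Finset.sum_le_sum fun j hj => ?_
            rw [Finset.sum_add_distrib]
            linarith [hexp l rfl j hj, hexp (-l) (by ring) j hj]
        _ = (2 * (P.card : ℝ)) * (E * Real.exp (h / 2)) := by
            rw [Finset.sum_const, nsmul_eq_mul]; ring
        _ ≤ Real.exp h * (E * Real.exp (h / 2)) := by gcongr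
        _ = E * Real.exp (3 / 2 * h) := by
            rw [mul_left_comm, ← Real.exp_add]; congr 2; ring
    have h3 := mul_le_mul_of_nonneg_left h2 (Real.exp_pos (-(3 / 2 * h))).le
    rw [mul_left_comm, ← Real.exp_add, neg_add_cancel, Real.exp_zero] at h3
    rw [hcard]
    linarith
  have hfin : E * (3 / 2 * h) = l * (E * (3 / 2 * s * √h)) := by
    rw [hl]
    field_simp
    rw [Real.sq_sqrt hh.le]
  rw [hfin] at hsum
  exact le_of_mul_le_mul_left hsum hlpos

/-! ### Packing numbers of set families of bounded VC dimension -/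

/-- If the members of `P` are pairwise `δ`-separated with respect to the probability weights `q`,
then `n` indices sampled from `q` miss a given symmetric difference with probability at most
`exp (-(n * δ))`; by the union bound, some sample of size `n` distinguishes all members of `P`. -/
theorem exists_card_le_injOn_inter {ι : Type*} [Fintype ι] [DecidableEq ι] {q : ι → ℝ}
    (hq : ∀ i, 0 ≤ q i) (hq1 : ∑ i, q i = 1) {P : Finset (Finset ι)} {δ : ℝ}
    (hsep : ∀ S ∈ P, ∀ T ∈ P, S ≠ T → δ ≤ ∑ i ∈ symmDiff S T, q i) {n : ℕ}
    (hn : (P.card : ℝ) ^ 2 * Real.exp (-(n * δ)) < 1) :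
    ∃ W : Finset ι, W.card ≤ n ∧ Set.InjOn (fun S => S ∩ W) (P : Set (Finset ι)) := by
  by_contra! hcon
  have hbad : ∀ ω : Fin n → ι, ∃ p ∈ P.offDiag, ∀ j, ω j ∉ symmDiff p.1 p.2 := by
    intro ω
    have h := hcon (Finset.univ.image ω) (Finset.card_image_le.trans (by simp))
    simp only [Set.InjOn, not_forall] at h
    obtain ⟨S, hS, T, hT, hST, hne⟩ := h
    refine ⟨(S, T), by simp_all, fun j hj => ?_⟩
    have := congrArg (ω j ∈ ·) hST
    simp [Finset.mem_symmDiff] at this hj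
    tauto
  have key : (1 : ℝ) ≤ ∑ p ∈ P.offDiag,
      (∑ i, if i ∈ symmDiff p.1 p.2 then 0 else q i) ^ n := by
    calc (1 : ℝ) = ∑ ω : Fin n → ι, ∏ j, q (ω j) := by
          rw [← Fintype.sum_pow, hq1, one_pow]
      _ ≤ ∑ ω : Fin n → ι, ∑ p ∈ P.offDiag,
            ∏ j, (if ω j ∈ symmDiff p.1 p.2 then 0 else q (ω j)) := by
          refine Finset.sum_le_sum fun ω _ => ?_
          obtain ⟨p, hp, hpω⟩ := hbad ω
          refine le_trans (le_of_eq ?_) (Finset.single_le_sum (f := fun p : Finset ι × Finset ι =>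
            ∏ j, (if ω j ∈ symmDiff p.1 p.2 then 0 else q (ω j))) (fun p _ => ?_) hp)
          · exact Finset.prod_congr rfl fun j _ => by rw [if_neg (hpω j)]
          · refine Finset.prod_nonneg fun j _ => ?_
            split_ifs
            · exact le_rfl
            · exact hq _
      _ = _ := by
          rw [Finset.sum_comm]
          refine Finset.sum_congr rfl fun p _ => ?_
          rw [Fintype.sum_pow]
  have hle : ∀ p ∈ P.offDiag,
      (∑ i, if i ∈ symmDiff p.1 p.2 then 0 else q i) ^ n ≤ Real.exp (-(n * δ)) := by
    intro p hp
    rw [Finset.mem_offDiag] at hp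
    have hsplit : (∑ i, if i ∈ symmDiff p.1 p.2 then 0 else q i) +
        ∑ i ∈ symmDiff p.1 p.2, q i = 1 := by
      rw [← Finset.sum_filter_add_sum_filter_not Finset.univ (· ∈ symmDiff p.1 p.2) q] at hq1
      rw [← hq1, add_comm]
      congr 1
      · exact Finset.sum_congr (by ext; simp) fun _ _ => rfl
      · rw [Finset.sum_filter]
        exact Finset.sum_congr rfl fun i _ => by split_ifs <;> simp_all
    have h0 : 0 ≤ ∑ i, if i ∈ symmDiff p.1 p.2 then 0 else q i :=
      Finset.sum_nonneg fun i _ => by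
        split_ifs
        · exact le_rfl
        · exact hq _
    have h1 := hsep _ hp.1 _ hp.2.1 hp.2.2
    rw [show -((n : ℝ) * δ) = n * (-δ) by ring, Real.exp_nat_mul]
    exact pow_le_pow_left₀ h0 (by linarith [Real.add_one_le_exp (-δ)]) n
  have h2 := key.trans (Finset.sum_le_card_nsmul _ _ _ hle)
  have h3 : ((P.offDiag.card : ℕ) : ℝ) ≤ (P.card : ℝ) ^ 2 := by
    rw [Finset.offDiag_card, sq]
    exact_mod_cast Nat.sub_le _ _
  rw [nsmul_eq_mul] at h2
  have := mul_le_mul_of_nonneg_right h3 (Real.exp_pos (-(n * δ))).le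
  linarith

/-- A set family of VC dimension at most `d` that is determined by its traces on `W` has at most
`∑ k ≤ d, (#W).choose k` members. That sum is bounded by weighing a `k`-element set with
`x ^ k / x ^ d`, where `x` is left free. -/
theorem card_le_of_injOn_inter {ι : Type*} [DecidableEq ι] {P : Finset (Finset ι)} {d : ℕ}
    (hd : P.vcDim ≤ d) {W : Finset ι}
    (hW : Set.InjOn (fun S => S ∩ W) (P : Set (Finset ι))) {x : ℝ} (hx : 0 < x) (hx1 : x ≤ 1) :
    (P.card : ℝ) ≤ (x ^ d)⁻¹ * Real.exp (W.card * x) := by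
  set 𝒯 := P.image (fun S => S ∩ W) with h𝒯
  have hsh : ∀ t ∈ 𝒯.shatterer, t ∈ W.powerset ∧ t.card ≤ d := by
    intro t ht
    rw [Finset.mem_shatterer] at ht
    have htW : t ⊆ W := by
      obtain ⟨u, hu, htu⟩ := ht.exists_superset
      obtain ⟨S, -, rfl⟩ := Finset.mem_image.1 hu
      exact htu.trans Finset.inter_subset_right
    refine ⟨Finset.mem_powerset.2 htW, le_trans (Finset.Shatters.card_le_vcDim ?_) hd⟩
    intro s hs
    obtain ⟨u, hu, htu⟩ := ht hs
    obtain ⟨S, hS, rfl⟩ := Finset.mem_image.1 hu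
    refine ⟨S, hS, ?_⟩
    rw [← htu, Finset.inter_comm S W, ← Finset.inter_assoc, Finset.inter_eq_left.2 htW]
  have h1 : P.card ≤ 𝒯.shatterer.card := by
    rw [← Finset.card_image_of_injOn hW]
    exact Finset.card_le_card_shatterer _
  calc (P.card : ℝ) ≤ 𝒯.shatterer.card := by exact_mod_cast h1
    _ = ∑ t ∈ 𝒯.shatterer, (1 : ℝ) := by simp
    _ ≤ ∑ t ∈ 𝒯.shatterer, (x ^ d)⁻¹ * x ^ t.card := by
        refine Finset.sum_le_sum fun t ht => ?_
        rw [inv_mul_eq_div, one_le_div (by positivity)]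
        exact pow_le_pow_of_le_one hx.le hx1 (hsh t ht).2
    _ ≤ ∑ t ∈ W.powerset, (x ^ d)⁻¹ * x ^ t.card :=
        Finset.sum_le_sum_of_subset_of_nonneg (fun t ht => (hsh t ht).1)
          fun _ _ _ => by positivity
    _ = (x ^ d)⁻¹ * (x + 1) ^ W.card := by
        rw [← Finset.mul_sum, ← Finset.sum_pow_mul_eq_add_pow]
        simp
    _ ≤ _ := by
        rw [Real.exp_nat_mul]
        gcongr
        exact Real.add_one_le_exp x

/-- Packing bound for set families of bounded VC dimension. -/
theorem card_le_of_separated {ι : Type*} [Fintype ι] [DecidableEq ι] {q : ι → ℝ}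
    (hq : ∀ i, 0 ≤ q i) (hq1 : ∑ i, q i = 1) {P : Finset (Finset ι)} {d : ℕ}
    (hd : P.vcDim ≤ d) {δ : ℝ} (hδ : 0 < δ) (hδ1 : δ ≤ 1)
    (hsep : ∀ S ∈ P, ∀ T ∈ P, S ≠ T → δ ≤ ∑ i ∈ symmDiff S T, q i) :
    (P.card : ℝ) ≤ Real.exp (1 / 2) * (4 / δ) ^ (2 * d) := by
  rcases P.card.eq_zero_or_pos with h0 | hpos
  · rw [h0, Nat.cast_zero]; positivity
  set M : ℝ := (P.card : ℝ) with hM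
  have hM1 : 1 ≤ M := Nat.one_le_cast.2 hpos
  have hMpos : 0 < M := by linarith
  have hlog : 0 ≤ Real.log M := Real.log_nonneg hM1
  -- A sample size for which the union bound over `M ^ 2` pairs succeeds.
  set n : ℕ := ⌊2 * Real.log M / δ⌋₊ + 1 with hn
  have hn_lt : 2 * Real.log M < n * δ := by
    rw [← div_lt_iff₀ hδ, hn]; push_cast; exact Nat.lt_floor_add_one _
  have hn_le : n * δ ≤ 2 * Real.log M + 1 := by
    have h := Nat.floor_le (show 0 ≤ 2 * Real.log M / δ by positivity)
    rw [le_div_iff₀ hδ] at h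
    rw [hn]; push_cast; linarith
  have hfew : M ^ 2 * Real.exp (-(n * δ)) < 1 := by
    rw [← Real.exp_log hMpos, ← Real.exp_nat_mul, ← Real.exp_add, Real.exp_lt_one_iff]
    push_cast
    linarith
  obtain ⟨W, hWn, hW⟩ := exists_card_le_injOn_inter hq hq1 hsep hfew
  -- With `x = δ / 4` the factor `exp (n * x)` is about `√M`, which the left-hand side absorbs.
  have hx := card_le_of_injOn_inter hd hW (x := δ / 4) (by positivity) (by linarith)
  have hWx : (W.card : ℝ) * (δ / 4) ≤ Real.log M / 2 + 1 / 4 := by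
    have : (W.card : ℝ) ≤ n := by exact_mod_cast hWn
    nlinarith
  have h2 : M ≤ (4 / δ) ^ d * Real.exp (Real.log M / 2 + 1 / 4) := by
    refine hx.trans ?_
    rw [← inv_pow, inv_div]
    gcongr
  have h3 : M * M ≤ M * (Real.exp (1 / 2) * (4 / δ) ^ (2 * d)) := by
    calc M * M ≤ ((4 / δ) ^ d * Real.exp (Real.log M / 2 + 1 / 4)) *
          ((4 / δ) ^ d * Real.exp (Real.log M / 2 + 1 / 4)) := by gcongr
      _ = (4 / δ) ^ (2 * d) * Real.exp (Real.log M + 1 / 2) := by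
          rw [mul_mul_mul_comm, ← Real.exp_add, ← pow_add]; congr 2 <;> ring
      _ = _ := by rw [Real.exp_add, Real.exp_log hMpos]; ring
  exact le_of_mul_le_mul_left h3 hMpos

/-- A `δ`-separated subfamily of maximal cardinality is a `δ`-net. -/
theorem exists_separated_net {ι : Type*} [DecidableEq ι] (q : ι → ℝ) (𝒜 : Finset (Finset ι))
    {δ : ℝ} (hδ : 0 < δ) :
    ∃ P ⊆ 𝒜, (∀ S ∈ P, ∀ T ∈ P, S ≠ T → δ ≤ ∑ i ∈ symmDiff S T, q i) ∧
      ∀ S ∈ 𝒜, ∃ T ∈ P, ∑ i ∈ symmDiff S T, q i < δ := by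
  classical
  let Sep : Finset (Finset ι) → Prop := fun P =>
    ∀ S ∈ P, ∀ T ∈ P, S ≠ T → δ ≤ ∑ i ∈ symmDiff S T, q i
  obtain ⟨P, hP, hmax⟩ := (𝒜.powerset.filter Sep).exists_max_image Finset.card
    ⟨∅, by simp [Sep]⟩
  rw [Finset.mem_filter, Finset.mem_powerset] at hP
  refine ⟨P, hP.1, hP.2, fun S hS => ?_⟩
  by_contra! hcon
  have hSP : S ∉ P := fun h => by
    have := hcon S h
    simp at this
    linarith
  have := hmax (insert S P) (by
    rw [Finset.mem_filter, Finset.mem_powerset]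
    refine ⟨Finset.insert_subset hS hP.1, fun A hA B hB hAB => ?_⟩
    rcases Finset.mem_insert.1 hA with rfl | hA' <;> rcases Finset.mem_insert.1 hB with rfl | hB'
    · exact absurd rfl hAB
    · exact hcon _ hB'
    · rw [symmDiff_comm]; exact hcon _ hA'
    · exact hP.2 _ hA' _ hB' hAB)
  rw [Finset.card_insert_of_notMem hSP] at this
  omega

/-! ### Chaining -/

theorem sum_sq_ite_sub_ite {ι : Type*} [Fintype ι] [DecidableEq ι] (m : ι → ℝ)
    (S T : Finset ι) :
    ∑ i, ((if i ∈ S then m i else 0) - (if i ∈ T then m i else 0)) ^ 2 =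
      ∑ i ∈ symmDiff S T, m i ^ 2 := by
  rw [← Finset.sum_subset (Finset.subset_univ (symmDiff S T))]
  · refine Finset.sum_congr rfl fun i hi => ?_
    rcases Finset.mem_symmDiff.1 hi with ⟨h, h'⟩ | ⟨h, h'⟩ <;> simp [h, h']
  · intro i _ hi
    by_cases h : i ∈ S <;> by_cases h' : i ∈ T <;> simp_all [Finset.mem_symmDiff]

/-- The chaining bound for normalised weights. -/
theorem sum_abs_signSum_le_of_vcDim_le_of_sum_sq_eq_one {ι : Type*} [Fintype ι] [DecidableEq ι]
    {𝒜 : Finset (Finset ι)} {d : ℕ} (hd1 : 1 ≤ d) (hd : 𝒜.vcDim ≤ d) {m : ι → ℝ}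
    (hm : ∑ i, m i ^ 2 = 1) (τ : (ι → ℤˣ) → Finset ι) (hτ : ∀ σ, τ σ ∈ 𝒜) :
    ∑ σ : ι → ℤˣ, |∑ i, ((σ i : ℤ) : ℝ) * (if i ∈ τ σ then m i else 0)| ≤
      2 ^ Fintype.card ι * (21 * √d) := by
  set a : Finset ι → ι → ℝ := fun S i => if i ∈ S then m i else 0 with ha
  set Y : Finset ι → (ι → ℤˣ) → ℝ := fun S σ => ∑ i, ((σ i : ℤ) : ℝ) * a S i with hY
  set E : ℝ := 2 ^ Fintype.card ι with hE
  have hEpos : 0 < E := by positivity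
  have hdR : (1 : ℝ) ≤ d := by exact_mod_cast hd1
  have hδpos : ∀ k : ℕ, (0 : ℝ) < ((1 / 2) ^ k) ^ 2 := fun k => by positivity
  choose F hFsub hFsep hFnet using fun k : ℕ =>
    exists_separated_net (fun i => m i ^ 2) 𝒜 (hδpos k)
  have hsel : ∀ k S, ∃ T, S ∈ 𝒜 → T ∈ F k ∧ ∑ i ∈ symmDiff S T, m i ^ 2 < ((1 / 2) ^ k) ^ 2 := by
    intro k S
    by_cases hS : S ∈ 𝒜
    · obtain ⟨T, hT⟩ := hFnet k S hS
      exact ⟨T, fun _ => hT⟩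
    · exact ⟨∅, fun h => absurd h hS⟩
  choose π hπ using hsel
  have hπ𝒜 : ∀ k S, S ∈ 𝒜 → π k S ∈ 𝒜 := fun k S hS => hFsub k (hπ k S hS).1
  -- The net with squared distances `4 ^ (-k)` has logarithmic size `O(d * (k + 1))`;
  -- the square of `k + 1` is a harmless loss that makes the square root below explicit.
  have hcard : ∀ k : ℕ, 2 * ((F k).card : ℝ) ≤ Real.exp (4 * d * (k + 1) ^ 2) := by
    intro k
    have h1 := card_le_of_separated (fun i => sq_nonneg (m i)) hm
      ((Finset.vcDim_mono (hFsub k)).trans hd) (hδpos k)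
      (by rw [← pow_mul]; exact pow_le_one₀ (by norm_num) (by norm_num)) (hFsep k)
    have h4 : (4 : ℝ) / ((1 / 2) ^ k) ^ 2 = Real.exp ((k + 1) * (2 * Real.log 2)) := by
      rw [show ((k : ℝ) + 1) * (2 * Real.log 2) = ((2 * (k + 1) : ℕ) : ℝ) * Real.log 2 by
        push_cast; ring, Real.exp_nat_mul, Real.exp_log two_pos]
      rw [one_div, inv_pow, inv_pow, div_inv_eq_mul]
      ring
    rw [h4, ← Real.exp_nat_mul, ← Real.exp_add] at h1
    calc 2 * ((F k).card : ℝ) ≤ Real.exp (Real.log 2) * Real.exp (1 / 2 +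
          ((2 * d : ℕ) : ℝ) * ((k + 1) * (2 * Real.log 2))) := by
          rw [Real.exp_log two_pos]; gcongr
      _ ≤ _ := by
          rw [← Real.exp_add]
          apply Real.exp_le_exp.2
          push_cast
          have hl := Real.log_two_lt_d9
          have hk : (1 : ℝ) ≤ (k : ℝ) + 1 := by linarith [(Nat.cast_nonneg k : (0 : ℝ) ≤ k)]
          have hdk : 1 ≤ (d : ℝ) * (k + 1) := one_le_mul_of_one_le_of_one_le hdR hk
          have hdk2 : (d : ℝ) * (k + 1) ≤ d * (k + 1) ^ 2 := by
            gcongr; exact le_self_pow₀ hk two_ne_zero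
          nlinarith
  have hsqrt : ∀ k : ℕ, √(4 * d * ((k : ℝ) + 1) ^ 2) = 2 * √d * (k + 1) := by
    intro k
    rw [Real.sqrt_mul (by positivity), Real.sqrt_mul (by positivity), Real.sqrt_sq (by positivity),
      show (4 : ℝ) = 2 ^ 2 by norm_num, Real.sqrt_sq (by norm_num)]
  -- The right-hand side is, in closed form, the cost `3 * √d` of the coarsest net plus the cost
  -- `3 * √d * (j + 2) * 2 ^ (-j)` of the links from level `j + 1` to level `j`, for `j < k`. Such a
  -- link depends only on the point at level `j + 1`, so its supremum is over a single net.
  have hchain : ∀ k : ℕ, ∀ τ : (ι → ℤˣ) → Finset ι, (∀ σ, τ σ ∈ 𝒜) →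
      ∑ σ, |Y (π k (τ σ)) σ| ≤ E * (3 * √d * (7 - (2 * k + 6) * (1 / 2) ^ k)) := by
    intro k
    induction k with
    | zero =>
      intro τ hτ
      have h := sum_abs_signSum_selection_le (F 0) a one_pos
        (h := 4 * d * (((0 : ℕ) : ℝ) + 1) ^ 2) (by positivity) (fun S _ => ?_) (hcard 0)
        (fun σ => π 0 (τ σ)) (fun σ => (hπ 0 _ (hτ σ)).1)
      · rw [hsqrt] at h
        refine h.trans (le_of_eq ?_)
        push_cast; ring
      · have := sum_sq_ite_sub_ite m S ∅
        simp only [Finset.notMem_empty, if_false, sub_zero] at this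
        rw [one_pow, ha, this, ← hm]
        exact Finset.sum_le_univ_sum_of_nonneg fun i => sq_nonneg _
    | succ k ih =>
      intro τ hτ
      have h1 := ih (fun σ => π (k + 1) (τ σ)) (fun σ => hπ𝒜 _ _ (hτ σ))
      have h2 := sum_abs_signSum_selection_le (F (k + 1)) (fun S i => a S i - a (π k S) i)
        (s := (1 / 2) ^ k) (by positivity)
        (h := 4 * d * (((k + 1 : ℕ) : ℝ) + 1) ^ 2) (by positivity) (fun S hS => ?_) (hcard (k + 1))
        (fun σ => π (k + 1) (τ σ)) (fun σ => (hπ (k + 1) _ (hτ σ)).1)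
      · rw [hsqrt] at h2
        calc ∑ σ, |Y (π (k + 1) (τ σ)) σ|
            ≤ ∑ σ, (|Y (π k (π (k + 1) (τ σ))) σ| + |∑ i, ((σ i : ℤ) : ℝ) *
                (a (π (k + 1) (τ σ)) i - a (π k (π (k + 1) (τ σ))) i)|) := by
              refine Finset.sum_le_sum fun σ _ => ?_
              simp only [mul_sub, Finset.sum_sub_distrib]
              linarith [abs_sub_abs_le_abs_sub (Y (π (k + 1) (τ σ)) σ)
                (Y (π k (π (k + 1) (τ σ))) σ)]
          _ ≤ _ := by
              rw [Finset.sum_add_distrib]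
              refine (add_le_add h1 h2).trans (le_of_eq ?_)
              push_cast; ring
      · rw [ha, sum_sq_ite_sub_ite]
        exact (hπ k S (hFsub _ hS)).2.le
  -- The distance to the net bounds each coordinate, hence also the residual of the chain.
  have hres : ∀ k : ℕ, ∑ σ, |Y (τ σ) σ| ≤
      E * (21 * √d) + E * Fintype.card ι * (1 / 2) ^ k := by
    intro k
    have hcoord : ∀ S ∈ 𝒜, ∀ σ : ι → ℤˣ,
        |∑ i, ((σ i : ℤ) : ℝ) * (a S i - a (π k S) i)| ≤ Fintype.card ι * (1 / 2) ^ k := by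
      intro S hS σ
      refine (Finset.abs_sum_le_sum_abs _ _).trans ?_
      refine (Finset.sum_le_card_nsmul _ _ ((1 / 2) ^ k) fun i _ => ?_).trans (by simp)
      have hσ : |((σ i : ℤ) : ℝ)| = 1 := by
        rcases Int.units_eq_one_or (σ i) with h | h <;> simp [h]
      rw [abs_mul, hσ, one_mul]
      refine abs_le_of_sq_le_sq ?_ (by positivity)
      calc (a S i - a (π k S) i) ^ 2 ≤ ∑ i, (a S i - a (π k S) i) ^ 2 :=
            Finset.single_le_sum (f := fun i => (a S i - a (π k S) i) ^ 2)
              (fun i _ => sq_nonneg _) (Finset.mem_univ i)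
        _ ≤ _ := by
            rw [ha, sum_sq_ite_sub_ite]
            exact (hπ k S hS).2.le
    calc ∑ σ, |Y (τ σ) σ| ≤ ∑ σ, (|Y (π k (τ σ)) σ| + Fintype.card ι * (1 / 2) ^ k) := by
          refine Finset.sum_le_sum fun σ _ => ?_
          have h := hcoord (τ σ) (hτ σ) σ
          simp only [mul_sub, Finset.sum_sub_distrib] at h
          linarith [abs_sub_abs_le_abs_sub (Y (τ σ) σ) (Y (π k (τ σ)) σ)]
      _ = ∑ σ, |Y (π k (τ σ)) σ| + E * (Fintype.card ι * (1 / 2) ^ k) := by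
          rw [Finset.sum_add_distrib]; simp [hE]
      _ ≤ _ := by
          have h0 : 0 ≤ √(d : ℝ) * ((2 * k + 6) * (1 / 2) ^ k) := by positivity
          nlinarith [hchain k τ hτ, mul_nonneg hEpos.le h0]
  have hlim : Filter.Tendsto
      (fun k : ℕ => E * (21 * √d) + E * Fintype.card ι * (1 / 2 : ℝ) ^ k) Filter.atTop
      (nhds (E * (21 * √d) + E * Fintype.card ι * 0)) :=
    tendsto_const_nhds.add
      ((tendsto_pow_atTop_nhds_zero_of_lt_one (by norm_num) (by norm_num)).const_mul _)
  rw [mul_zero, add_zero] at hlim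
  exact ge_of_tendsto' hlim hres

theorem sum_abs_signSum_le_of_vcDim_le {ι : Type*} [Fintype ι] [DecidableEq ι]
    {𝒜 : Finset (Finset ι)} {d : ℕ} (hd1 : 1 ≤ d) (hd : 𝒜.vcDim ≤ d) (m : ι → ℝ)
    (τ : (ι → ℤˣ) → Finset ι) (hτ : ∀ σ, τ σ ∈ 𝒜) :
    ∑ σ : ι → ℤˣ, |∑ i, ((σ i : ℤ) : ℝ) * (if i ∈ τ σ then m i else 0)| ≤
      2 ^ Fintype.card ι * (21 * √d * √(∑ i, m i ^ 2)) := by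
  set r := √(∑ i, m i ^ 2) with hr
  have hr2 : r ^ 2 = ∑ i, m i ^ 2 := Real.sq_sqrt (Finset.sum_nonneg fun i _ => sq_nonneg _)
  rcases (Real.sqrt_nonneg (∑ i, m i ^ 2)).eq_or_lt with h0 | hpos
  · rw [← hr] at h0
    rw [← h0, zero_pow two_ne_zero, eq_comm,
      Finset.sum_eq_zero_iff_of_nonneg fun i _ => sq_nonneg _] at hr2
    have hm0 : ∀ i, m i = 0 := fun i => pow_eq_zero_iff two_ne_zero |>.1 (hr2 i (Finset.mem_univ i))
    simp [hm0, ← h0]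
  · rw [← hr] at hpos
    have h := sum_abs_signSum_le_of_vcDim_le_of_sum_sq_eq_one hd1 hd (m := fun i => m i / r)
      (by simp_rw [div_pow]; rw [← Finset.sum_div, ← hr2, div_self (by positivity)]) τ hτ
    calc _ = r * ∑ σ : ι → ℤˣ, |∑ i, ((σ i : ℤ) : ℝ) * (if i ∈ τ σ then m i / r else 0)| := by
          rw [Finset.mul_sum]
          refine Finset.sum_congr rfl fun σ _ => ?_
          rw [← abs_of_pos hpos, ← abs_mul, abs_of_pos hpos, Finset.mul_sum]
          congr 1
          refine Finset.sum_congr rfl fun i _ => ?_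
          split_ifs
          · field_simp
          · simp
      _ ≤ r * (2 ^ Fintype.card ι * (21 * √d)) := by gcongr
      _ = _ := by ring

/-! ### Traces of subgraphs and the pseudo-dimension -/

open Classical in
/-- The sets of indices `i` for which the point `p i` of `X × ℝ` lies strictly below the graph of
`f`, where `f` runs over `F`: the traces on the family `p` of the subgraphs of `F`. -/
noncomputable def subgraphTraces {X ι : Type*} [Fintype ι] (F : Set (X → ℝ)) (p : ι → X × ℝ) :
    Finset (Finset ι) :=
  {A | ∃ f ∈ F, ∀ i, i ∈ A ↔ (p i).2 < f (p i).1}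

/-- Two indices of a shattered set cannot have points on the same vertical line, since a subgraph
that contains the upper one contains the lower one. So a shattered set of indices projects
injectively to `X`, and the heights of its points are thresholds that shatter the projection. -/
theorem vcDim_subgraphTraces_le {X ι : Type*} [Fintype ι] [DecidableEq ι] (F : Set (X → ℝ))
    (p : ι → X × ℝ) : ((subgraphTraces F p).vcDim : ℕ∞) ≤ vcDim F := by
  classical
  suffices H : ∀ I, (subgraphTraces F p).Shatters I → (I.card : ℕ∞) ≤ vcDim F by
    rcases (subgraphTraces F p).shatterer.eq_empty_or_nonempty with h | h
    · simp [Finset.vcDim, h]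
    · obtain ⟨I, hI, h⟩ := Finset.exists_mem_eq_sup _ h Finset.card
      rw [Finset.vcDim, h]
      exact H I (Finset.mem_shatterer.1 hI)
  intro I hI
  have hcut : ∀ T ⊆ I, ∃ f ∈ F, ∀ i ∈ I, (p i).2 < f (p i).1 ↔ i ∈ T := by
    intro T hT
    obtain ⟨A, hA, rfl⟩ := hI hT
    obtain ⟨f, hf, hfA⟩ := (Finset.mem_filter.1 hA).2
    exact ⟨f, hf, fun i hi => by rw [← hfA, Finset.mem_inter, and_iff_right hi]⟩
  have hmono : ∀ i ∈ I, ∀ j ∈ I, (p i).1 = (p j).1 → (p i).2 ≤ (p j).2 → i = j := by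
    intro i hi j hj hx ht
    obtain ⟨f, -, hf⟩ := hcut {j} (by simpa using hj)
    have h := (hf j hj).2 (Finset.mem_singleton_self j)
    exact Finset.mem_singleton.1 ((hf i hi).1 (by rw [hx]; exact ht.trans_lt h))
  have hinj : Set.InjOn (fun i => (p i).1) (I : Set ι) := by
    intro i hi j hj hx
    rcases le_total (p i).2 (p j).2 with ht | ht
    · exact hmono i hi j hj hx ht
    · exact (hmono j hj i hi hx.symm ht).symm
  have hr : ∃ r : X → ℝ, ∀ i ∈ I, r (p i).1 = (p i).2 := by
    rcases isEmpty_or_nonempty ι with hι | hι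
    · exact ⟨0, fun i => hι.elim i⟩
    · exact ⟨fun x => (p (Function.invFunOn (fun i => (p i).1) (I : Set ι) x)).2,
        fun i hi => by
          have := hinj.leftInvOn_invFunOn hi
          dsimp only at this ⊢
          rw [this]⟩
  obtain ⟨r, hr⟩ := hr
  have hsh : PseudoShatters F (I.image fun i => (p i).1) := by
    refine ⟨r, fun T _ => ?_⟩
    obtain ⟨f, hf, hfT⟩ := hcut (I.filter fun i => (p i).1 ∈ T) (Finset.filter_subset _ _)
    refine ⟨f, hf, fun x hx => ?_⟩
    obtain ⟨i, hi, rfl⟩ := Finset.mem_image.1 hx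
    rw [hr i hi, hfT i hi, Finset.mem_filter, and_iff_right hi]
  rw [← Finset.card_image_of_injOn hinj]
  exact le_iSup₂_of_le (f := fun (S : Finset X) (_ : PseudoShatters F S) => (S.card : ℕ∞))
    _ hsh le_rfl

/-! ### Reduction of integrals to point evaluations -/

theorem integral_subgraph_indicator {y : ℝ} (h0 : 0 ≤ y) (h1 : y ≤ 1) :
    ∫ t in Set.Ioc (0 : ℝ) 1, (if t < y then (1 : ℝ) else 0) = y := by
  have : (fun t : ℝ => if t < y then (1 : ℝ) else 0) = (Set.Iio y).indicator 1 := by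
    ext t; simp [Set.indicator_apply]
  rw [this, integral_indicator_one measurableSet_Iio, measureReal_restrict_apply measurableSet_Iio,
    show Set.Iio y ∩ Set.Ioc 0 1 = Set.Ioo 0 y from ?_]
  · simp [h0]
  · ext t
    simp only [Set.mem_inter_iff, Set.mem_Iio, Set.mem_Ioc, Set.mem_Ioo]
    constructor
    · rintro ⟨a, b, c⟩; exact ⟨b, a⟩
    · rintro ⟨a, b⟩; exact ⟨b, a, by linarith⟩

/-- The Rademacher average of the integrals is at most the mean of the Rademacher averages of the
subgraph traces on independent random points of `X × (0, 1]`. -/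
theorem sum_abs_signSum_integral_le {X ι : Type*} [MeasurableSpace X] [Nonempty X] [Fintype ι]
    [DecidableEq ι] {F : Set (X → ℝ)} (hFm : ∀ f ∈ F, Measurable f)
    (hF01 : ∀ f ∈ F, ∀ x, f x ∈ Set.Icc (0 : ℝ) 1) {d : ℕ} (hd1 : 1 ≤ d) (hd : vcDim F ≤ d)
    (μ : ι → FiniteMeasure X) (f : (ι → ℤˣ) → X → ℝ) (hf : ∀ σ, f σ ∈ F) :
    ∑ σ : ι → ℤˣ, |∑ i, ((σ i : ℤ) : ℝ) * ∫ x, f σ x ∂(μ i : Measure X)| ≤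
      2 ^ Fintype.card ι * (21 * √d * √(∑ i, ((μ i).mass : ℝ) ^ 2)) := by
  classical
  set C : ℝ := 2 ^ Fintype.card ι * (21 * √d * √(∑ i, ((μ i).mass : ℝ) ^ 2)) with hC
  let U : Measure ℝ := volume.restrict (Set.Ioc 0 1)
  have : IsProbabilityMeasure U := ⟨by simp [U]⟩
  let ν : ι → Measure (X × ℝ) := fun i => ((μ i).normalize : Measure X).prod U
  let Q : Measure (ι → X × ℝ) := Measure.pi ν
  let g : (ι → ℤˣ) → X × ℝ → ℝ := fun σ p => if p.2 < f σ p.1 then 1 else 0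
  have hgm : ∀ σ, Measurable (g σ) := fun σ =>
    Measurable.ite (measurableSet_lt measurable_snd ((hFm _ (hf σ)).comp measurable_fst))
      measurable_const measurable_const
  have hgb : ∀ σ p, ‖g σ p‖ ≤ 1 := fun σ p => by simp only [g]; split_ifs <;> simp
  have hgint : ∀ σ i, ∫ x, f σ x ∂(μ i : Measure X) =
      ((μ i).mass : ℝ) * ∫ ω, g σ (ω i) ∂Q := by
    intro σ i
    rw [integral_comp_eval (μ := ν) (f := g σ) (hgm σ).aestronglyMeasurable,
      integral_prod _ (Integrable.of_bound (hgm σ).aestronglyMeasurable 1 (ae_of_all _ (hgb σ)))]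
    have hx : ∀ x, ∫ t, g σ (x, t) ∂U = f σ x := fun x =>
      integral_subgraph_indicator (hF01 _ (hf σ) x).1 (hF01 _ (hf σ) x).2
    simp_rw [hx]
    conv_lhs => rw [(μ i).self_eq_mass_smul_normalize]
    rw [FiniteMeasure.toMeasure_smul, integral_smul_nnreal_measure]
    rfl
  have hgi : ∀ σ i, Integrable (fun ω => g σ (ω i)) Q := fun σ i =>
    Integrable.of_bound ((hgm σ).comp (measurable_pi_apply i)).aestronglyMeasurable 1
      (ae_of_all _ fun ω => hgb σ (ω i))
  let Z : (ι → ℤˣ) → (ι → X × ℝ) → ℝ := fun σ ω =>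
    ∑ i, ((σ i : ℤ) : ℝ) * (((μ i).mass : ℝ) * g σ (ω i))
  have hZi : ∀ σ, Integrable (Z σ) Q := fun σ =>
    integrable_finsetSum _ fun i _ => ((hgi σ i).const_mul _).const_mul _
  have hpt : ∀ ω, ∑ σ, |Z σ ω| ≤ C := by
    intro ω
    have hd' : (subgraphTraces F ω).vcDim ≤ d := by
      exact_mod_cast (vcDim_subgraphTraces_le F ω).trans hd
    have h := sum_abs_signSum_le_of_vcDim_le hd1 hd' (fun i => ((μ i).mass : ℝ))
      (fun σ => Finset.univ.filter fun i => (ω i).2 < f σ (ω i).1)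
      (fun σ => Finset.mem_filter.2 ⟨Finset.mem_univ _, f σ, hf σ, fun i => by simp⟩)
    convert h using 6 with σ _ i
    simp [g]
  calc _ = ∑ σ, |∫ ω, Z σ ω ∂Q| := by
        refine Finset.sum_congr rfl fun σ _ => ?_
        rw [integral_finsetSum _ fun i _ => ((hgi σ i).const_mul _).const_mul _]
        simp_rw [integral_const_mul, hgint]
    _ ≤ ∑ σ, ∫ ω, |Z σ ω| ∂Q := Finset.sum_le_sum fun σ _ => abs_integral_le_integral_abs
    _ = ∫ ω, ∑ σ, |Z σ ω| ∂Q := (integral_finsetSum _ fun σ _ => (hZi σ).abs).symm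
    _ ≤ ∫ _, C ∂Q := integral_mono (integrable_finsetSum _ fun σ _ => (hZi σ).abs)
        (integrable_const C) hpt
    _ = C := by simp

/-! ### The Rademacher complexity -/

/-- The suprema of a finite sum may be taken by independent choices in the summands. -/
theorem ENNReal.sum_iSup_le_of_forall_selection {S G : Type*} [Nonempty G] (s : Finset S)
    (a : S → G → ℝ≥0∞) {C : ℝ≥0∞} (h : ∀ τ : S → G, ∑ σ ∈ s, a σ (τ σ) ≤ C) :
    ∑ σ ∈ s, ⨆ g, a σ g ≤ C := by
  classical
  suffices H : ∀ b : ℝ≥0∞, (∀ τ : S → G, b + ∑ σ ∈ s, a σ (τ σ) ≤ C) →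
      b + ∑ σ ∈ s, ⨆ g, a σ g ≤ C by simpa using H 0 (by simpa using h)
  clear h
  induction s using Finset.induction_on with
  | empty => intro b hb; simpa using hb
  | insert x s hx ih =>
    intro b hb
    rw [Finset.sum_insert hx, ← add_assoc, ENNReal.add_iSup, ENNReal.iSup_add]
    refine iSup_le fun g => ih _ fun τ => ?_
    have h := hb (Function.update τ x g)
    rw [Finset.sum_insert hx, Function.update_self, ← add_assoc] at h
    convert h using 2
    refine Finset.sum_congr rfl fun σ hσ => ?_
    rw [Function.update_of_ne (by rintro rfl; exact hx hσ)]

theorem mainTheorem1 :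
    ∃ K : ℝ≥0, ∀ (X : Type*) [MetricSpace X] [CompactSpace X] [MeasurableSpace X] [BorelSpace X]
      (F : Set (X → ℝ)), (∀ f ∈ F, Measurable f) → (∀ f ∈ F, ∀ x, f x ∈ Set.Icc (0 : ℝ) 1) →
      1 ≤ vcDim F →
      ∀ (N : ℕ), 1 ≤ N → ∀ (μ : Fin N → FiniteMeasure X),
        rademacherComplexity (integralClass F) μ ≤
          (K : ℝ≥0∞) * (quadraticMeanMass μ : ℝ≥0∞) * ((vcDim F : ℕ∞) : ℝ≥0∞) ^ (1 / 2 : ℝ) /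
            (N : ℝ≥0∞) ^ (1 / 2 : ℝ) := by
  refine ⟨21, fun X _ _ _ _ F hFm hF01 hvc N hN μ => ?_⟩
  have hNR : (0 : ℝ) < N := by exact_mod_cast hN
  have hXF : Nonempty X ∧ F.Nonempty := by
    by_contra hcon
    have h0 : vcDim F ≤ 0 := by
      refine iSup₂_le fun S hS => ?_
      obtain ⟨r, hr⟩ := hS
      obtain ⟨f, hf, -⟩ := hr ∅ (Finset.empty_subset S)
      have : IsEmpty X := not_nonempty_iff.1 fun h => hcon ⟨h, f, hf⟩
      simp [Finset.eq_empty_of_isEmpty S]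
    exact absurd (hvc.trans h0) (by simp)
  obtain ⟨hX, hFne⟩ := hXF
  have : Nonempty F := hFne.to_subtype
  -- A bound on all selections of functions bounds the suprema in the Rademacher complexity.
  have hred : ∀ B : ℝ, (∀ f : (Fin N → ℤˣ) → X → ℝ, (∀ σ, f σ ∈ F) →
      ∑ σ : Fin N → ℤˣ, |∑ i, ((σ i : ℤ) : ℝ) * ∫ x, f σ x ∂(μ i : Measure X)| ≤ 2 ^ N * B) →
      rademacherComplexity (integralClass F) μ ≤ ENNReal.ofReal (B / N) := by
    intro B hB
    have hsum : ∑ σ : Fin N → ℤˣ, ⨆ g ∈ integralClass F,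
        ENNReal.ofReal |∑ i, ((σ i : ℤ) : ℝ) * g (μ i)| ≤ ENNReal.ofReal (2 ^ N * B) := by
      simp_rw [integralClass, iSup_image, ← iSup_subtype'']
      refine ENNReal.sum_iSup_le_of_forall_selection _ _ fun τ => ?_
      rw [← ENNReal.ofReal_sum_of_nonneg fun σ _ => abs_nonneg _]
      exact ENNReal.ofReal_le_ofReal (hB (fun σ => τ σ) fun σ => (τ σ).2)
    have h2 : (2 ^ N : ℝ≥0∞) = ENNReal.ofReal (2 ^ N) := by
      rw [ENNReal.ofReal_pow two_pos.le]; simp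
    calc rademacherComplexity (integralClass F) μ
        ≤ (N : ℝ≥0∞)⁻¹ * ((2 ^ N : ℝ≥0∞)⁻¹ * ENNReal.ofReal (2 ^ N * B)) := by
          unfold rademacherComplexity; gcongr
      _ = ENNReal.ofReal (B / N) := by
          rw [h2, ← ENNReal.ofReal_natCast N, ← ENNReal.ofReal_inv_of_pos hNR,
            ← ENNReal.ofReal_inv_of_pos (by positivity), ← ENNReal.ofReal_mul (by positivity),
            ← ENNReal.ofReal_mul (by positivity)]
          congr 1
          field_simp
  have hquad : ((quadraticMeanMass μ : ℝ≥0) : ℝ) =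
      √(∑ i, ((μ i).mass : ℝ) ^ 2) / √N := by
    rw [quadraticMeanMass, Real.coe_sqrt]
    push_cast
    rw [Real.sqrt_div' _ hNR.le]
  by_cases htop : vcDim F = ⊤
  · rcases eq_or_ne (quadraticMeanMass μ) 0 with hM | hM
    · -- Here the right-hand side is `0 * ∞ = 0`, and all the measures vanish.
      have h0 : ∑ i, ((μ i).mass : ℝ) ^ 2 = 0 := by
        rw [hM, NNReal.coe_zero, eq_comm, div_eq_zero_iff] at hquad
        rcases hquad with h | h
        · exact (Real.sqrt_eq_zero (Finset.sum_nonneg fun i _ => sq_nonneg _)).1 h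
        · exact absurd h (Real.sqrt_pos.2 hNR).ne'
      rw [Finset.sum_eq_zero_iff_of_nonneg fun i _ => sq_nonneg _] at h0
      have hμ : ∀ i, μ i = 0 := fun i => by
        rw [← FiniteMeasure.mass_zero_iff]
        exact_mod_cast (pow_eq_zero_iff two_ne_zero).1 (h0 i (Finset.mem_univ i))
      refine (hred 0 fun f _ => ?_).trans (by simp)
      simp [hμ]
    · have hr : (((⊤ : ℕ∞) : ℝ≥0∞)) ^ (1 / 2 : ℝ) = ⊤ := by
        rw [ENat.toENNReal_top]; exact ENNReal.top_rpow_of_pos (by norm_num)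
      rw [htop, hr, ENNReal.mul_top (by simpa using hM), ENNReal.top_div_of_ne_top]
      · exact le_top
      · exact ENNReal.rpow_ne_top_of_nonneg (by norm_num) (ENNReal.natCast_ne_top N)
  · obtain ⟨d, hd⟩ := ENat.ne_top_iff_exists.1 htop
    rw [← hd] at hvc
    have hd1 : 1 ≤ d := by exact_mod_cast hvc
    refine (hred _ fun f hf => (sum_abs_signSum_integral_le hFm hF01 hd1 hd.ge μ f hf).trans
      (by rw [Fintype.card_fin])).trans (le_of_eq ?_)
    have hroot : ∀ n : ℕ, (n : ℝ≥0∞) ^ (1 / 2 : ℝ) = ENNReal.ofReal √n := fun n => by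
      rw [Real.sqrt_eq_rpow, ← ENNReal.ofReal_rpow_of_nonneg (Nat.cast_nonneg n) (by norm_num),
        ENNReal.ofReal_natCast]
    rw [← hd, ENat.toENNReal_coe, hroot, hroot, ← ENNReal.ofReal_coe_nnreal,
      ← ENNReal.ofReal_coe_nnreal, hquad, ← ENNReal.ofReal_mul (by simp),
      ← ENNReal.ofReal_mul (by positivity), ← ENNReal.ofReal_div_of_pos (Real.sqrt_pos.2 hNR)]
    congr 1
    have hN2 : √(N : ℝ) * √N = N := Real.mul_self_sqrt hNR.le
    have hsN := Real.sqrt_pos.2 hNR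
    set S := √(∑ i, ((μ i).mass : ℝ) ^ 2)
    calc 21 * √(d : ℝ) * S / N = 21 * √(d : ℝ) * S / (√N * √N) := by rw [hN2]
      _ = ((21 : ℝ≥0) : ℝ) * (S / √N) * √d / √N := by push_cast; field_simp
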